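/- Let $p$ be an odd prime such that the elliptic curve $E: Y^2 = X^3 - 432p^2$ has positive rank over $\mathbb{Q}$. Then the equation $x^3 + y^3 = p^4 z^3$ has infinitely many solutions in nonzero, pairwise coprime integers $x, y, z$. Moreover, let $P \in E(\mathbb{Q})$ be any point of infinite order (in particular, any generator of infinite order), and let $k \ge 1$ be an integer. Then $(3pk)P$ can be written as $(u/d^2, v/d^3)$ with integers $u, v, d$ such that $d \ne 0$ and $\gcd(uv, d) = 1$, and for every such $u, v, d$ the following holds: $p \mid d$; the rational numbers $$A = \frac{36pd^3 + v}{6ud}, \qquad B = \frac{36pd^3 - v}{6ud}$$ have, in lowest terms, the same denominator $D > 0$; $p \mid D$; and if $x$ and $y$ are the numerators of $A$ and $B$ in lowest terms and $z = D/p$, then $x, y, z$ are nonzero, pairwise coprime integers with $x^3 + y^3 = p^4 z^3$. -/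

import Mathlib

/-- The elliptic curve `Y² = X³ - 432 p²` over `ℚ`. -/
def cubeCurve (p : ℕ) : WeierstrassCurve.Affine ℚ where
  a₁ := 0
  a₂ := 0
  a₃ := 0
  a₄ := 0
  a₆ := -432 * (p : ℚ) ^ 2

/-- `Q` is the affine point `(u / d², v / d³)`, with `d ≠ 0` and `uv` prime to `d`.
The integers `u, v, d` are determined by `Q` up to replacing `(v, d)` by `(-v, -d)`. -/
def HasLowestTerms {p : ℕ} (Q : (cubeCurve p).Point) (u v d : ℤ) : Prop :=
  d ≠ 0 ∧ IsCoprime (u * v) d ∧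
    ∃ h : (cubeCurve p).Nonsingular ((u : ℚ) / (d : ℚ) ^ 2) ((v : ℚ) / (d : ℚ) ^ 3),
      Q = WeierstrassCurve.Affine.Point.some ((u : ℚ) / (d : ℚ) ^ 2) ((v : ℚ) / (d : ℚ) ^ 3) h

/-- `(x, y, z)` is a solution of `x³ + y³ = p⁴ z³` in nonzero, pairwise coprime integers. -/
def IsCoprimeSolution (p : ℕ) (x y z : ℤ) : Prop :=
  x ^ 3 + y ^ 3 = (p : ℤ) ^ 4 * z ^ 3 ∧
    IsCoprime x y ∧ IsCoprime x z ∧ IsCoprime y z ∧ x ≠ 0 ∧ y ≠ 0 ∧ z ≠ 0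

/-- The rational number `(36 p d³ + v) / (6 u d)`. -/
def ratioPlus (p : ℕ) (u v d : ℤ) : ℚ :=
  (36 * (p : ℚ) * (d : ℚ) ^ 3 + (v : ℚ)) / (6 * (u : ℚ) * (d : ℚ))

/-- The rational number `(36 p d³ - v) / (6 u d)`. -/
def ratioMinus (p : ℕ) (u v d : ℤ) : ℚ :=
  (36 * (p : ℚ) * (d : ℚ) ^ 3 - (v : ℚ)) / (6 * (u : ℚ) * (d : ℚ))

open WeierstrassCurve.Affine

/-! The substitution `A + B = 12p/X`, `A - B = Y/(3X)` identifies `E` with the cubic `A³ + B³ = p`.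
A rational solution whose denominator is divisible by `p` clears to `x³ + y³ = p⁴z³`, so everything
rests on `p ∣ d` for the multiples `(3pk)P`.

This is a local statement at `p`, where `E` reduces to the cuspidal cubic `y² = x³`. In the
coordinates `z = x/y`, `w = 1/y` the points of nonsingular reduction are the integral ones
(`NearInfinity`). They are closed under addition, and `z` is additive on them modulo the maximal
ideal (`nearInfinity_add`). Multiplication by `p` therefore makes `z` small, which forces a pole of
`y` (`one_lt_of_nsmul_eq`). The factor `3` brings every point into nonsingular reduction
(`nearInfinity_three_nsmul`); for `p = 3` all points are already there
(`one_le_padicValuation_three`).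

Infinitude follows because distinct multiples of `P` give distinct pairs `(A, B)`. -/

namespace Mordell

/-! ### Identities for three collinear points -/

section Chord

variable {K : Type*} [Field K] {a x₁ x₂ y₁ y₂ l m : K}

/-- Three collinear points of `y² = x³ + a`, in the coordinates `(x, y)`. -/
theorem prod_y_of_collinear (h₁ : y₁ = l * x₁ + m) (h₂ : y₂ = l * x₂ + m)
    (ha : y₁ ^ 2 = x₁ ^ 3 + a) (hl : l * (y₁ + y₂) = x₁ ^ 2 + x₁ * x₂ + x₂ ^ 2) :
    y₁ * y₂ * (l * (l ^ 2 - x₁ - x₂) + m) = m ^ 3 - a * l ^ 3 := by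
  obtain rfl : a = y₁ ^ 2 - x₁ ^ 3 := by linear_combination -ha
  subst h₁ h₂
  -- `e₂` and `e₃` are Vieta's relations for `x³ + a - (lx + m)²`; `hl` covers chord and tangent
  -- alike.
  have e₂ : x₁ * x₂ + (l ^ 2 - x₁ - x₂) * (x₁ + x₂) + 2 * l * m = 0 := by
    linear_combination hl
  have e₃ : x₁ * x₂ * (l ^ 2 - x₁ - x₂) - m ^ 2 + ((l * x₁ + m) ^ 2 - x₁ ^ 3) = 0 := by
    linear_combination x₁ * e₂
  linear_combination l ^ 3 * e₃ + l ^ 2 * m * e₂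

/-- Divided by `y₁y₂y₃`, this expresses the sum of the three `z = x/y` with a visible factor `a`. -/
theorem sum_z_of_collinear (h₁ : y₁ = l * x₁ + m) (h₂ : y₂ = l * x₂ + m)
    (ha : y₁ ^ 2 = x₁ ^ 3 + a) (hl : l * (y₁ + y₂) = x₁ ^ 2 + x₁ * x₂ + x₂ ^ 2) :
    x₁ * y₂ * (l * (l ^ 2 - x₁ - x₂) + m) + x₂ * y₁ * (l * (l ^ 2 - x₁ - x₂) + m) +
      (l ^ 2 - x₁ - x₂) * y₁ * y₂ = -3 * a * l ^ 2 := by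
  obtain rfl : a = y₁ ^ 2 - x₁ ^ 3 := by linear_combination -ha
  subst h₁ h₂
  have e₂ : x₁ * x₂ + (l ^ 2 - x₁ - x₂) * (x₁ + x₂) + 2 * l * m = 0 := by
    linear_combination hl
  have e₃ : x₁ * x₂ * (l ^ 2 - x₁ - x₂) - m ^ 2 + ((l * x₁ + m) ^ 2 - x₁ ^ 3) = 0 := by
    linear_combination x₁ * e₂
  linear_combination 3 * l ^ 2 * e₃ + 2 * l * m * e₂

/-- In the coordinates `z`, `w` the curve is `w = z³ + aw³` and the line has slope `-l/m`.
Subtracting the equations of two points gives this slope as `(z₁² + z₁z₂ + z₂²) / (1 - a(w₁² + w₁w₂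
+ w₂²))`. -/
theorem slope_at_infinity_of_collinear (h₁ : y₁ = l * x₁ + m) (h₂ : y₂ = l * x₂ + m)
    (ha : y₁ ^ 2 = x₁ ^ 3 + a) (hl : l * (y₁ + y₂) = x₁ ^ 2 + x₁ * x₂ + x₂ ^ 2) :
    -l * (y₁ ^ 2 * y₂ ^ 2 - a * (y₁ ^ 2 + y₁ * y₂ + y₂ ^ 2)) =
      m * (x₁ ^ 2 * y₂ ^ 2 + x₁ * x₂ * y₁ * y₂ + x₂ ^ 2 * y₁ ^ 2) := by
  obtain rfl : a = y₁ ^ 2 - x₁ ^ 3 := by linear_combination -ha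
  subst h₁ h₂
  linear_combination (l * x₁ + m) ^ 3 * hl

end Chord

/-! ### Integrality in the coordinates at infinity -/

section Valued

variable {K : Type*} [Field K] {Γ : Type*} [LinearOrderedCommGroupWithZero Γ] (v : Valuation K Γ)

/-- `(x, y)` is integral in the coordinates `(x / y, 1 / y)` around the point at infinity. -/
def IntegralAtInfinity (x y : K) : Prop := y ≠ 0 ∧ v (x / y) ≤ 1 ∧ v (1 / y) ≤ 1

variable {v} {a x₁ x₂ y₁ y₂ l : K}

/-- The slope `t` in the `(z, w)` plane is integral, its denominator being a unit, and so is the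
intercept `1/m`. Substituting the line into the cubic gives leading coefficient `1 + at³`, a unit,
so the sum of the roots `-3at²(1/m)/(1 + at³)` is small. -/
theorem IntegralAtInfinity.collinear (hv : v a < 1) (i₁ : IntegralAtInfinity v x₁ y₁)
    (i₂ : IntegralAtInfinity v x₂ y₂) (h : y₂ - y₁ = l * (x₂ - x₁))
    (ha : y₁ ^ 2 = x₁ ^ 3 + a) (hl : l * (y₁ + y₂) = x₁ ^ 2 + x₁ * x₂ + x₂ ^ 2) :
    IntegralAtInfinity v (l ^ 2 - x₁ - x₂) (l * (l ^ 2 - x₁ - x₂ - x₁) + y₁) ∧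
      v ((l ^ 2 - x₁ - x₂) / (l * (l ^ 2 - x₁ - x₂ - x₁) + y₁) + x₁ / y₁ + x₂ / y₂) < 1 := by
  obtain ⟨m, h₁⟩ : ∃ m, y₁ = l * x₁ + m := ⟨y₁ - l * x₁, by ring⟩
  have h₂ : y₂ = l * x₂ + m := by linear_combination h + h₁
  have e₁ := prod_y_of_collinear h₁ h₂ ha hl
  have e₂ := sum_z_of_collinear h₁ h₂ ha hl
  have e₃ := slope_at_infinity_of_collinear h₁ h₂ ha hl
  have hy₃ : l * (l ^ 2 - x₁ - x₂ - x₁) + y₁ = l * (l ^ 2 - x₁ - x₂) + m := by rw [h₁]; ring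
  rw [hy₃]
  clear hl ha h hy₃
  generalize l ^ 2 - x₁ - x₂ = x₃ at *
  obtain ⟨y₃, h₃⟩ : ∃ y₃, y₃ = l * x₃ + m := ⟨_, rfl⟩
  rw [← h₃] at e₁ e₂ ⊢
  obtain ⟨n₁, iz₁, iw₁⟩ := i₁
  obtain ⟨n₂, iz₂, iw₂⟩ := i₂
  let O := v.integer
  obtain ⟨z₁, hz₁⟩ : ∃ z, z = x₁ / y₁ := ⟨_, rfl⟩
  obtain ⟨z₂, hz₂⟩ : ∃ z, z = x₂ / y₂ := ⟨_, rfl⟩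
  obtain ⟨w₁, hw₁⟩ : ∃ z, z = 1 / y₁ := ⟨_, rfl⟩
  obtain ⟨w₂, hw₂⟩ : ∃ z, z = 1 / y₂ := ⟨_, rfl⟩
  rw [← hz₁] at iz₁
  rw [← hz₂] at iz₂
  rw [← hw₁] at iw₁
  rw [← hw₂] at iw₂
  have small {x y : K} (hx : v x < 1) (hy : v y ≤ 1) : v (x * y) < 1 := by
    rw [map_mul]; exact mul_lt_one_of_lt_of_le hx hy
  have oz₁ : z₁ ∈ O := iz₁
  have oz₂ : z₂ ∈ O := iz₂
  have ow₁ : w₁ ∈ O := iw₁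
  have ow₂ : w₂ ∈ O := iw₂
  have hN : v (1 - a * (w₁ ^ 2 + w₁ * w₂ + w₂ ^ 2)) = 1 := by
    apply v.map_one_sub_of_lt
    refine small hv (?_ : _ ∈ O)
    exact add_mem (add_mem (pow_mem ow₁ _) (mul_mem ow₁ ow₂)) (pow_mem ow₂ _)
  have e₃' : -l * (1 - a * (w₁ ^ 2 + w₁ * w₂ + w₂ ^ 2)) =
      m * (z₁ ^ 2 + z₁ * z₂ + z₂ ^ 2) := by
    rw [hz₁, hz₂, hw₁, hw₂]
    field_simp
    linear_combination e₃
  have hm : m ≠ 0 := by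
    rintro rfl
    have hN0 : 1 - a * (w₁ ^ 2 + w₁ * w₂ + w₂ ^ 2) ≠ 0 := by
      intro h0; rw [h0, map_zero] at hN; exact zero_ne_one hN
    have : l = 0 := by simpa [hN0] using e₃'
    apply n₁; rw [h₁, this]; ring
  obtain ⟨t, ht⟩ : ∃ t, t = -l / m := ⟨_, rfl⟩
  have ot : t ∈ O := by
    have : t * (1 - a * (w₁ ^ 2 + w₁ * w₂ + w₂ ^ 2)) = z₁ ^ 2 + z₁ * z₂ + z₂ ^ 2 := by
      rw [ht, div_mul_eq_mul_div, e₃', mul_div_cancel_left₀ _ hm]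
    have h' := congrArg v this
    rw [map_mul, hN, mul_one] at h'
    change v t ≤ 1
    rw [h']
    exact add_mem (S := Subring K) (s := O)
      (add_mem (pow_mem oz₁ _) (mul_mem oz₁ oz₂)) (pow_mem oz₂ _)
  have hu : 1 / m = w₁ - t * z₁ := by
    rw [ht, hw₁, hz₁]; field_simp; rw [h₁]; ring
  have ou : 1 / m ∈ O := by rw [hu]; exact sub_mem ow₁ (mul_mem ot oz₁)
  have hD : v (1 + a * t ^ 3) = 1 :=
    v.map_one_add_of_lt (small hv (show t ^ 3 ∈ O from pow_mem ot 3))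
  have hD0 : 1 + a * t ^ 3 ≠ 0 := by
    intro h0; rw [h0, map_zero] at hD; exact zero_ne_one hD
  have hDm : m ^ 3 - a * l ^ 3 = m ^ 3 * (1 + a * t ^ 3) := by
    rw [ht]; field_simp; ring
  have n₃ : y₃ ≠ 0 := by
    rintro rfl
    rw [mul_zero, hDm] at e₁
    exact mul_ne_zero (pow_ne_zero 3 hm) hD0 e₁.symm
  have hsum : x₃ / y₃ + z₁ + z₂ = a * (-3 * t ^ 2 * (1 / m)) / (1 + a * t ^ 3) := by
    have hs : x₃ / y₃ + z₁ + z₂ = -3 * a * l ^ 2 / (y₁ * y₂ * y₃) := by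
      rw [← e₂, hz₁, hz₂]; field_simp; ring
    rw [hs, e₁, hDm, ht]
    field_simp
  have o3 : (-3 : K) ∈ O := by exact_mod_cast intCast_mem O (-3)
  have vsum : v (x₃ / y₃ + z₁ + z₂) < 1 := by
    rw [hsum, map_div₀, hD, div_one]
    exact small hv (mul_mem (S := Subring K) (s := O) (mul_mem o3 (pow_mem ot 2)) ou)
  have oz₃ : x₃ / y₃ ∈ O := by
    have : x₃ / y₃ = (x₃ / y₃ + z₁ + z₂) - z₁ - z₂ := by ring
    rw [this]
    exact sub_mem (sub_mem (show _ ∈ O from vsum.le) oz₁) oz₂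
  refine ⟨⟨n₃, oz₃, ?_⟩, by rwa [← hz₁, ← hz₂]⟩
  have : 1 / y₃ = t * (x₃ / y₃) + 1 / m := by
    rw [ht]; field_simp; rw [h₃]; ring
  rw [this]
  exact add_mem (S := Subring K) (s := O) (mul_mem ot oz₃) ou

theorem integralAtInfinity_of_one_le {x y : K} (hv : v a < 1) (h : y ^ 2 = x ^ 3 + a)
    (hy : 1 ≤ v y) : IntegralAtInfinity v x y := by
  have h0 : 0 < v y := zero_lt_one.trans_le hy
  have n : y ≠ 0 := by rintro rfl; simp at h0
  have hx : v x ^ 3 ≤ v y ^ 3 := by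
    rw [← map_pow, show x ^ 3 = y ^ 2 - a by linear_combination -h]
    refine v.map_sub_le ?_ (hv.le.trans (one_le_pow₀ hy))
    rw [map_pow]
    exact pow_le_pow_right₀ hy (by norm_num)
  have hx' : v x ≤ v y := le_of_pow_le_pow_left₀ (by norm_num) h0.le hx
  refine ⟨n, ?_, ?_⟩
  · rw [map_div₀]; exact (div_le_one₀ h0).2 hx'
  · rw [map_div₀, map_one]; exact (div_le_one₀ h0).2 hy

/-- The reduction `y² = x³` is singular only at the origin, which is excluded when `x` does not
reduce to `0`. -/
theorem integralAtInfinity_of_one_le_left {x y : K} (hv : v a < 1) (h : y ^ 2 = x ^ 3 + a)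
    (hx : 1 ≤ v x) : IntegralAtInfinity v x y := by
  refine integralAtInfinity_of_one_le hv h ?_
  have h3 : 1 ≤ v x ^ 3 := one_le_pow₀ hx
  have : v y ^ 2 = v x ^ 3 := by
    rw [← map_pow, h, v.map_add_eq_of_lt_left, map_pow]
    rw [map_pow]; exact hv.trans_le h3
  by_contra! hlt
  exact absurd (this ▸ h3) (not_le.2 (pow_lt_one₀ zero_le hlt (by norm_num)))

end Valued

end Mordell

/-! ### The group law and reduction -/

namespace Mordell

/-- The curve `y² = x³ + a`. -/
def curve {K : Type*} [Field K] (a : K) : WeierstrassCurve.Affine K := ⟨0, 0, 0, 0, a⟩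

variable {K : Type*} [Field K] {a : K}

theorem eq_of_nonsingular {x y : K} (h : (curve a).Nonsingular x y) : y ^ 2 = x ^ 3 + a := by
  simpa [curve] using ((curve a).equation_iff x y).1 h.1

theorem negY_eq (x y : K) : (curve a).negY x y = -y := by simp [curve, negY]

variable {Γ : Type*} [LinearOrderedCommGroupWithZero Γ] (v : Valuation K Γ)

/-- Points that are integral in the coordinates `(x / y, 1 / y)`. -/
def NearInfinity : (curve a).Point → Prop
  | .zero => True
  | .some x y _ => IntegralAtInfinity v x y

/-- The function `x / y`, a local parameter at the point at infinity. -/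
def param : (curve a).Point → K
  | .zero => 0
  | .some x y _ => x / y

variable {v}

theorem nearInfinity_zero : NearInfinity v (0 : (curve a).Point) := trivial

theorem param_zero : param (0 : (curve a).Point) = 0 := rfl

theorem param_le_one {P : (curve a).Point} (hP : NearInfinity v P) : v (param P) ≤ 1 := by
  rcases P with _ | ⟨x, y, h⟩
  · rw [← Point.zero_def, param_zero, map_zero]; exact zero_le_one
  · exact hP.2.1

variable [DecidableEq K]

/-- Two points with nonzero sum have a line through them, tangent if they coincide. -/
theorem exists_slope {x₁ y₁ x₂ y₂ : K} (h₁ : (curve a).Nonsingular x₁ y₁)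
    (h₂ : (curve a).Nonsingular x₂ y₂) (hne : ¬(x₁ = x₂ ∧ y₁ = -y₂)) :
    ∃ l h₃, y₂ - y₁ = l * (x₂ - x₁) ∧ l * (y₁ + y₂) = x₁ ^ 2 + x₁ * x₂ + x₂ ^ 2 ∧
      Point.some x₁ y₁ h₁ + Point.some x₂ y₂ h₂ =
        Point.some (W' := curve a) (l ^ 2 - x₁ - x₂) (-(l * (l ^ 2 - x₁ - x₂ - x₁) + y₁)) h₃ := by
  have e₁ := eq_of_nonsingular h₁
  have e₂ := eq_of_nonsingular h₂
  have hadd := Point.add_some (W := curve a) (h₁ := h₁) (h₂ := h₂) (by rwa [negY_eq])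
  have hX (l : K) : (curve a).addX x₁ x₂ l = l ^ 2 - x₁ - x₂ := by simp [curve, addX]
  have hY (l : K) : (curve a).addY x₁ x₂ y₁ l = -(l * (l ^ 2 - x₁ - x₂ - x₁) + y₁) := by
    rw [addY, negY_eq, negAddY, hX]
  simp only [hX, hY] at hadd
  refine ⟨_, _, ?_, ?_, hadd⟩
  · by_cases hx : x₁ = x₂
    · have : y₁ = y₂ := by
        have : (y₁ - y₂) * (y₁ + y₂) = 0 := by subst hx; linear_combination e₁ - e₂
        rcases mul_eq_zero.1 this with h | h
        · exact sub_eq_zero.1 h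
        · exact absurd ⟨hx, eq_neg_of_add_eq_zero_left h⟩ hne
      subst hx this; simp
    · rw [slope_of_X_ne hx]
      have := sub_ne_zero.2 hx
      field_simp; ring
  · by_cases hx : x₁ = x₂
    · have hy : y₁ ≠ (curve a).negY x₂ y₂ := by rw [negY_eq]; exact fun h => hne ⟨hx, h⟩
      have hy' : y₁ = y₂ := Y_eq_of_Y_ne h₁.1 h₂.1 hx hy
      rw [slope_of_Y_ne hx hy]
      subst hx hy'
      rw [negY_eq] at hy ⊢
      have hy2 : y₁ + y₁ ≠ 0 := fun h => hy (eq_neg_of_add_eq_zero_left h)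
      simp only [curve]
      rw [sub_neg_eq_add, div_mul_cancel₀ _ hy2]; ring
    · rw [slope_of_X_ne hx]
      have := sub_ne_zero.2 hx
      field_simp; linear_combination e₁ - e₂

/-- The nonsingular points of the cuspidal cubic form an additive group with coordinate `x/y`. -/
theorem nearInfinity_add (hv : v a < 1) {P Q : (curve a).Point} (hP : NearInfinity v P)
    (hQ : NearInfinity v Q) :
    NearInfinity v (P + Q) ∧ v (param (P + Q) - (param P + param Q)) < 1 := by
  rcases P with _ | ⟨x₁, y₁, h₁⟩
  · rw [← Point.zero_def, zero_add]; simp [hQ, param_zero]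
  rcases Q with _ | ⟨x₂, y₂, h₂⟩
  · rw [← Point.zero_def, add_zero]; simp [hP, param_zero]
  by_cases hne : x₁ = x₂ ∧ y₁ = -y₂
  · rw [Point.add_of_Y_eq hne.1 (by rw [negY_eq]; exact hne.2)]
    refine ⟨nearInfinity_zero, ?_⟩
    obtain ⟨rfl, rfl⟩ := hne
    simp [param, div_neg]
  obtain ⟨l, h₃, hl, hl', hsum⟩ := exists_slope h₁ h₂ hne
  obtain ⟨⟨n, i, j⟩, k⟩ := IntegralAtInfinity.collinear hv hP hQ hl (eq_of_nonsingular h₁) hl'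
  rw [hsum]
  refine ⟨⟨neg_ne_zero.2 n, by rwa [div_neg, v.map_neg], by rwa [div_neg, v.map_neg]⟩, ?_⟩
  -- The third collinear point is `-(P + Q)`, and `x/y` is odd.
  rw [← v.map_neg]
  convert k using 2
  simp only [param, div_neg]
  ring

theorem nearInfinity_nsmul (hv : v a < 1) {P : (curve a).Point} (hP : NearInfinity v P) (n : ℕ) :
    NearInfinity v (n • P) ∧ v (param (n • P) - n * param P) < 1 := by
  induction n with
  | zero => simp [nearInfinity_zero, param_zero]
  | succ n ih =>
    obtain ⟨h, h'⟩ := nearInfinity_add hv ih.1 hP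
    rw [succ_nsmul]
    refine ⟨h, ?_⟩
    have := v.map_add_lt h' ih.2
    convert this using 2
    push_cast; ring

/-- Multiplication by the residue characteristic maps into the kernel of reduction. -/
theorem one_lt_of_nsmul_eq (hv : v a < 1) {P : (curve a).Point} (hP : NearInfinity v P) {n : ℕ}
    (hn : v (n : K) < 1) {x y : K} {h : (curve a).Nonsingular x y}
    (hx : n • P = Point.some x y h) : 1 < v y := by
  obtain ⟨h₁, h₂⟩ := nearInfinity_nsmul hv hP n
  have h₃ : v (param (n • P)) < 1 := by
    have : v (n * param P) < 1 := by
      rw [map_mul]; exact mul_lt_one_of_lt_of_le hn (param_le_one hP)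
    simpa using v.map_add_lt h₂ this
  rw [hx] at h₁ h₃
  obtain ⟨n0, iz, iw⟩ := h₁
  change v (x / y) < 1 at h₃
  by_contra! hy
  have hw : v (1 / y) < 1 := by
    -- The equation `w = z³ + aw³`: since `1 - aw²` is a unit, small `z` forces small `w`.
    have e : 1 / y * (1 - a * (1 / y) ^ 2) = (x / y) ^ 3 := by
      have := eq_of_nonsingular h
      field_simp; linear_combination this
    have hu : v (1 - a * (1 / y) ^ 2) = 1 := by
      apply v.map_one_sub_of_lt
      rw [map_mul, map_pow]
      exact mul_lt_one_of_lt_of_le hv (pow_le_one₀ zero_le iw)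
    have e' := congrArg v e
    rw [map_mul, hu, mul_one, map_pow] at e'
    rw [e']; exact pow_lt_one₀ zero_le h₃ (by norm_num)
  rw [map_div₀, map_one] at hw
  exact absurd hw (not_lt.2 ((one_le_div₀ (v.pos_iff.2 n0)).2 hy))

/-- The component group at a place where `a` is the square of a uniformizer up to a unit is
killed by three. -/
theorem nearInfinity_three_nsmul {π : Γ} (hπ : π < 1) (h2 : v 2 = 1) (hv : v a = π ^ 2)
    (hdisc : ∀ x : K, v x < 1 → v x ≤ π) (P : (curve a).Point) :
    NearInfinity v (3 • P) := by
  have h3 : v 3 ≤ 1 := by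
    have : (3 : K) ∈ v.integer := by exact_mod_cast natCast_mem v.integer 3
    exact this
  have hv1 : v a < 1 := by rw [hv]; exact pow_lt_one₀ zero_le hπ (by norm_num)
  by_cases hP : NearInfinity v P
  · exact (nearInfinity_nsmul hv1 hP 3).1
  rcases P with _ | ⟨x, y, h⟩
  · exact absurd nearInfinity_zero hP
  have e := eq_of_nonsingular h
  have hx : v x ≤ π := by
    refine hdisc x (not_le.1 fun hx => hP ?_)
    exact integralAtInfinity_of_one_le_left hv1 e hx
  by_cases hπ0 : π = 0
  · subst hπ0
    have hx0 : x = 0 := v.zero_iff.1 (le_antisymm hx zero_le)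
    have ha0 : a = 0 := v.zero_iff.1 (by simpa using hv)
    have hy0 : y = 0 := by simpa [hx0, ha0] using e
    exfalso
    have := ((curve a).nonsingular_iff x y).1 h
    simp [curve, hx0, hy0] at this
  have hπp : 0 < π := zero_lt_iff.2 hπ0
  have hπ2 : π ^ 2 < π := by
    rw [pow_two]; exact mul_lt_of_lt_one_left hπp hπ
  have hπ3 : π ^ 3 < π ^ 2 := pow_lt_pow_right_of_lt_one₀ hπp hπ (by norm_num)
  have hy : v y = π := by
    have : v y ^ 2 = π ^ 2 := by
      rw [← map_pow, e, v.map_add_eq_of_lt_right, hv]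
      rw [hv, map_pow]; exact (pow_le_pow_left₀ zero_le hx 3).trans_lt hπ3
    exact (pow_left_inj₀ zero_le zero_le two_ne_zero).1 this
  have hy0 : y ≠ 0 := by rintro rfl; rw [map_zero] at hy; exact hπ0 hy.symm
  have h20 : (2 : K) ≠ 0 := by intro h0; rw [h0, map_zero] at h2; exact zero_ne_one h2
  have hyy : ¬(x = x ∧ y = -y) := by
    rintro ⟨-, h'⟩
    have : 2 * y = 0 := by linear_combination h'
    exact (mul_ne_zero h20 hy0) this
  obtain ⟨l, h₂, -, hl, hsum⟩ := exists_slope h h hyy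
  have hvl : v l ≤ π := by
    have e' : l * (2 * y) = 3 * x ^ 2 := by linear_combination hl
    have := congrArg v e'
    rw [map_mul, map_mul, h2, one_mul, hy, map_mul, map_pow] at this
    have hle : v l * π ≤ π * π := by
      rw [this, ← pow_two]
      exact (mul_le_of_le_one_left zero_le h3).trans (pow_le_pow_left₀ zero_le hx 2)
    exact le_of_mul_le_mul_right hle hπp
  have e₂ := eq_of_nonsingular h₂
  rw [show 3 • Point.some x y h = Point.some x y h + (Point.some x y h + Point.some x y h) by
    abel, hsum]
  have hx₂ : v (l ^ 2 - x - x) ≤ π := by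
    refine v.map_sub_le (v.map_sub_le ?_ hx) hx
    rw [map_pow]; exact (pow_le_pow_left₀ zero_le hvl 2).trans hπ2.le
  -- The tangent slope is small, so the ordinate of `2P` is close to `-y`. The chord from `P` to
  -- `2P` then has rise of valuation exactly `π` and run at most `π`; its slope is not small, hence
  -- neither is the abscissa of `3P`.
  have hy₂ : v (-(l * (l ^ 2 - x - x - x) + y) - y) = π := by
    rw [show -(l * (l ^ 2 - x - x - x) + y) - y = -(l * (l ^ 2 - x - x - x) + 2 * y) by ring,
      v.map_neg, v.map_add_eq_of_lt_right, map_mul, h2, one_mul, hy]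
    rw [map_mul, map_mul, h2, one_mul, hy]
    refine (mul_le_mul' hvl (v.map_sub_le hx₂ hx)).trans_lt ?_
    rwa [← pow_two]
  generalize l ^ 2 - x - x = x₂ at *
  generalize -(l * (x₂ - x) + y) = y₂ at *
  by_cases hne : x = x₂ ∧ y = -y₂
  · rw [Point.add_of_Y_eq hne.1 (by rw [negY_eq]; exact hne.2)]
    exact nearInfinity_zero
  obtain ⟨k, h₃, hk, -, hsum'⟩ := exists_slope h h₂ hne
  have hvk : 1 ≤ v k := by
    have := congrArg v hk
    rw [map_mul, hy₂] at this
    by_contra! hlt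
    have hd := v.map_sub_le hx₂ hx
    have : π < π := by
      calc π = v k * v (x₂ - x) := this
        _ ≤ v k * π := mul_le_mul_right hd _
        _ < π := mul_lt_of_lt_one_left hπp hlt
    exact this.false
  rw [hsum']
  refine integralAtInfinity_of_one_le_left hv1 (eq_of_nonsingular h₃) ?_
  have hk2 : 1 ≤ v (k ^ 2) := by rw [map_pow]; exact one_le_pow₀ hvk
  have h1 : v (k ^ 2 - x) = v (k ^ 2) :=
    v.map_sub_eq_of_lt_left (hx.trans_lt (hπ.trans_le hk2))
  rw [v.map_sub_eq_of_lt_left, h1]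
  · exact hk2
  · rw [h1]; exact hx₂.trans_lt (hπ.trans_le hk2)

end Mordell

/-! ### Denominators of rational points and of sums of two cubes -/

namespace Mordell

/-- Coordinates of a rational point on `y² = x³ + c`, with `c` an integer, in lowest terms. -/
theorem exists_lowest_terms {x y : ℚ} {c : ℤ} (h : y ^ 2 = x ^ 3 + c) :
    ∃ u v d : ℤ, d ≠ 0 ∧ IsCoprime (u * v) d ∧ x = u / (d : ℚ) ^ 2 ∧ y = v / (d : ℚ) ^ 3 := by
  have hx := Rat.num_div_den x
  have hy := Rat.num_div_den y
  have cx : IsCoprime x.num (x.den : ℤ) := x.isCoprime_num_den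
  have cy : IsCoprime y.num (y.den : ℤ) := y.isCoprime_num_den
  have key : y.num ^ 2 * (x.den : ℤ) ^ 3 =
      (y.den : ℤ) ^ 2 * (x.num ^ 3 + c * (x.den : ℤ) ^ 3) := by
    have hs : (x.den : ℚ) ≠ 0 := by exact_mod_cast x.den_nz
    have hq : (y.den : ℚ) ≠ 0 := by exact_mod_cast y.den_nz
    rw [← hx, ← hy] at h
    field_simp at h
    have : (y.num : ℚ) ^ 2 * (x.den : ℚ) ^ 3 =
      (y.den : ℚ) ^ 2 * ((x.num : ℚ) ^ 3 + c * (x.den : ℚ) ^ 3) := by linear_combination h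
    exact_mod_cast this
  have d₁ : (y.den : ℤ) ^ 2 ∣ (x.den : ℤ) ^ 3 :=
    (cy.symm.pow (m := 2) (n := 2)).dvd_of_dvd_mul_left (key ▸ dvd_mul_right _ _)
  have d₂ : (x.den : ℤ) ^ 3 ∣ (y.den : ℤ) ^ 2 := by
    have hc : IsCoprime ((x.den : ℤ) ^ 3) (x.num ^ 3 + c * (x.den : ℤ) ^ 3) :=
      IsCoprime.add_mul_right_right cx.symm.pow c
    exact hc.dvd_of_dvd_mul_right (key ▸ dvd_mul_left _ _)
  have e : x.den ^ 3 = y.den ^ 2 :=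
    Nat.dvd_antisymm (by exact_mod_cast d₂) (by exact_mod_cast d₁)
  obtain ⟨d, hd⟩ : x.den ∣ y.den :=
    (Nat.pow_dvd_pow_iff two_ne_zero).1 (e ▸ pow_dvd_pow _ (by norm_num))
  have hxd : x.den = d ^ 2 := by
    have : x.den ^ 2 * x.den = x.den ^ 2 * d ^ 2 := by rw [← pow_succ, e, hd]; ring
    exact Nat.eq_of_mul_eq_mul_left (pow_pos x.den_pos 2) this
  have hyd : y.den = d ^ 3 := by rw [hd, hxd]; ring
  rw [hxd] at hx cx
  rw [hyd] at hy cy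
  push_cast at hx hy cx cy
  refine ⟨x.num, y.num, d, ?_, ?_, ?_, ?_⟩
  · rintro h0
    have : d = 0 := by exact_mod_cast h0
    exact x.den_nz (by rw [hxd, this]; rfl)
  · exact ((IsCoprime.pow_right_iff (by norm_num)).1 cx).mul_left
      ((IsCoprime.pow_right_iff (by norm_num)).1 cy)
  · rw [Int.cast_natCast]; exact hx.symm
  · rw [Int.cast_natCast]; exact hy.symm

theorem den_dvd_of_cube_add_cube {A B : ℚ} {n : ℤ} (h : A ^ 3 + B ^ 3 = n) : A.den ∣ B.den := by
  have hA : (A.den : ℚ) ≠ 0 := by exact_mod_cast A.den_nz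
  have hB : (B.den : ℚ) ≠ 0 := by exact_mod_cast B.den_nz
  rw [← Rat.num_div_den A, ← Rat.num_div_den B] at h
  field_simp at h
  have key : A.num ^ 3 * (B.den : ℤ) ^ 3 =
      (A.den : ℤ) ^ 3 * (n * (B.den : ℤ) ^ 3 - B.num ^ 3) := by
    have : (A.num : ℚ) ^ 3 * (B.den : ℚ) ^ 3 =
      (A.den : ℚ) ^ 3 * (n * (B.den : ℚ) ^ 3 - (B.num : ℚ) ^ 3) := by linear_combination h
    exact_mod_cast this
  have hd : (A.den : ℤ) ^ 3 ∣ (B.den : ℤ) ^ 3 :=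
    (A.isCoprime_num_den.symm.pow (m := 3) (n := 3)).dvd_of_dvd_mul_left (key ▸ dvd_mul_right _ _)
  exact_mod_cast (Int.pow_dvd_pow_iff (by norm_num)).1 hd

/-- A rational solution of `A³ + B³ = p` with denominator divisible by `p`. -/
theorem isCoprimeSolution_of_cube_add_cube {p : ℕ} (hp : p.Prime) {A B : ℚ}
    (h : A ^ 3 + B ^ 3 = p) (hpA : p ∣ A.den) :
    A.den = B.den ∧ ∃ z : ℤ, (A.den : ℤ) = p * z ∧ IsCoprimeSolution p A.num B.num z := by
  have hAB : A.den = B.den := Nat.dvd_antisymm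
    (den_dvd_of_cube_add_cube (n := p) (by exact_mod_cast h))
    (den_dvd_of_cube_add_cube (n := p) (by rw [add_comm]; exact_mod_cast h))
  have hne {C : ℚ} (hC : p ∣ C.den) : C.num ≠ 0 := by
    intro h0
    rw [Rat.num_eq_zero.1 h0] at hC
    exact hp.one_lt.ne' (Nat.dvd_one.1 hC)
  have hpA' : (p : ℤ) ∣ A.den := by exact_mod_cast hpA
  obtain ⟨z, hz⟩ := hpA'
  have cA : IsCoprime A.num (A.den : ℤ) := A.isCoprime_num_den
  have cB : IsCoprime B.num (A.den : ℤ) := hAB ▸ B.isCoprime_num_den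
  have hsum : A.num ^ 3 + B.num ^ 3 = p * (A.den : ℤ) ^ 3 := by
    have hA : (A.den : ℚ) ≠ 0 := by exact_mod_cast A.den_nz
    have hA' := Rat.num_div_den A
    have hB' := Rat.num_div_den B
    rw [← hAB] at hB'
    rw [← hA', ← hB'] at h
    field_simp at h
    rw [mul_comm (p : ℤ)]
    exact_mod_cast h
  refine ⟨hAB, z, hz, ?_, ?_, ?_, ?_, hne hpA, hne (hAB ▸ hpA), ?_⟩
  · rw [hsum, hz]; ring
  · refine isCoprime_of_prime_dvd (fun h0 => hne hpA h0.1) fun q hq hqA hqB => ?_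
    -- Even if `q = p`, it divides the denominator, because `p` does.
    have hqs : q ∣ p * (A.den : ℤ) ^ 3 :=
      hsum ▸ dvd_add (dvd_pow hqA (by norm_num)) (dvd_pow hqB (by norm_num))
    have hqD : q ∣ (A.den : ℤ) := by
      rcases hq.dvd_or_dvd hqs with h' | h'
      · exact hz ▸ h'.mul_right z
      · exact hq.dvd_of_dvd_pow h'
    exact hq.not_isUnit (cA.isUnit_of_dvd' hqA hqD)
  · exact cA.of_isCoprime_of_dvd_right (Dvd.intro_left _ hz.symm)
  · exact cB.of_isCoprime_of_dvd_right (Dvd.intro_left _ hz.symm)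
  · rintro rfl
    exact A.den_nz (by exact_mod_cast hz.trans (mul_zero _))

/-! ### The local argument at `p` -/

section Padic

variable {p : ℕ} [hp : Fact p.Prime]

theorem padicValuation_le_of_lt_one {x : ℚ} (hx : Rat.padicValuation p x < 1) :
    Rat.padicValuation p x ≤ Rat.padicValuation p p := by
  rw [Rat.padicValuation_self]
  refine (WithZero.lt_mul_exp_iff_le WithZero.exp_ne_zero).1 ?_
  rwa [← WithZero.exp_add, neg_add_cancel, WithZero.exp_zero]

theorem padicValuation_self_lt_one : Rat.padicValuation p (p : ℚ) < 1 := by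
  have := (Int.padicValuation_lt_one_iff (p := p) (x := p)).2 dvd_rfl
  rwa [← Rat.padicValuation_cast, Int.cast_natCast] at this

theorem padicValuation_self_pos : 0 < Rat.padicValuation p (p : ℚ) := by
  rw [Rat.padicValuation_self]; exact WithZero.exp_pos

theorem exists_eq_mul_of_lt_one {x : ℚ} (hx : Rat.padicValuation p x < 1) :
    ∃ y, x = p * y ∧ Rat.padicValuation p y ≤ 1 := by
  have hp0 : (p : ℚ) ≠ 0 := by exact_mod_cast hp.out.ne_zero
  refine ⟨x / p, by field_simp, ?_⟩
  rw [map_div₀]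
  exact (div_le_one₀ padicValuation_self_pos).2 (padicValuation_le_of_lt_one hx)

theorem padicValuation_int_eq_one {n : ℤ} (h : ¬ (p : ℤ) ∣ n) : Rat.padicValuation p n = 1 := by
  rw [Rat.padicValuation_cast]; exact Int.padicValuation_eq_one_iff.2 h

theorem padicValuation_int_le_one (n : ℤ) : Rat.padicValuation p n ≤ 1 := by
  rw [Rat.padicValuation_cast]; exact Int.padicValuation_le_one p n

/-- At `3` every point of `y² = x³ - 432 · 3²` has nonsingular reduction. -/
theorem one_le_padicValuation_three [Fact (Nat.Prime 3)] {x y : ℚ} (h : y ^ 2 = x ^ 3 - 3888) :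
    1 ≤ Rat.padicValuation 3 x := by
  set v := Rat.padicValuation 3
  have h3 : v 3 < 1 := by exact_mod_cast padicValuation_self_lt_one (p := 3)
  have lt_of_sq {t s : ℚ} (hs : v s ≤ 1) (ht : t ^ 2 = 3 * s) : v t < 1 := by
    by_contra! hle
    have : 1 ≤ v (t ^ 2) := by rw [map_pow]; exact one_le_pow₀ hle
    rw [ht, map_mul] at this
    exact absurd (mul_lt_one_of_lt_of_le h3 hs) (not_lt.2 this)
  have int_mem (n : ℤ) : (n : ℚ) ∈ v.integer := padicValuation_int_le_one n
  have ofNat_mem (n : ℕ) : (n : ℚ) ∈ v.integer := by exact_mod_cast int_mem n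
  have mem (m n : ℕ) (k : ℕ) {t : ℚ} (ht : t ∈ v.integer) : v (m * t ^ k - n) ≤ 1 :=
    (sub_mem (mul_mem (ofNat_mem m) (pow_mem ht k)) (ofNat_mem n) : _ ∈ v.integer)
  -- Descent: `3 ∣ x` peels off powers of `3` until `x = 9x₂`, `y = 27y₃`. Since `3888 = 243 · 16`,
  -- this leaves `16 = 3(x₂³ - y₃²)`, which is impossible.
  by_contra! hx
  obtain ⟨x₁, rfl, hx₁ : x₁ ∈ v.integer⟩ := exists_eq_mul_of_lt_one hx
  push_cast at h
  obtain ⟨y₁, rfl, -⟩ := exists_eq_mul_of_lt_one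
    (lt_of_sq (t := y) (mem 9 1296 3 hx₁) (by push_cast; linear_combination h))
  push_cast at h
  obtain ⟨y₂, rfl, hy₂ : y₂ ∈ v.integer⟩ := exists_eq_mul_of_lt_one
    (lt_of_sq (t := y₁) (mem 1 144 3 hx₁) (by push_cast; linear_combination h / 9))
  push_cast at h
  have hx₁' : v x₁ < 1 := by
    by_contra! hle
    have h1 : 1 ≤ v (x₁ ^ 3) := by rw [map_pow]; exact one_le_pow₀ hle
    rw [show x₁ ^ 3 = 3 * (y₂ ^ 2 - (-48 : ℤ)) by push_cast; linear_combination -h / 27,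
      map_mul] at h1
    refine absurd (mul_lt_one_of_lt_of_le h3 (?_ : v _ ≤ 1)) (not_lt.2 h1)
    exact (sub_mem (pow_mem hy₂ 2) (int_mem (-48)) : _ ∈ v.integer)
  obtain ⟨x₂, rfl, hx₂ : x₂ ∈ v.integer⟩ := exists_eq_mul_of_lt_one hx₁'
  push_cast at h
  obtain ⟨y₃, rfl, hy₃ : y₃ ∈ v.integer⟩ := exists_eq_mul_of_lt_one
    (lt_of_sq (t := y₂) (mem 3 16 3 hx₂) (by push_cast; linear_combination h / 81))
  push_cast at h
  have h16 : v ((16 : ℤ) : ℚ) < 1 := by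
    rw [show ((16 : ℤ) : ℚ) = 3 * (x₂ ^ 3 - y₃ ^ 2) by push_cast; linear_combination h / 243,
      map_mul]
    refine mul_lt_one_of_lt_of_le h3 (?_ : v _ ≤ 1)
    exact (sub_mem (pow_mem hx₂ 3) (pow_mem hy₃ 2) : _ ∈ v.integer)
  rw [padicValuation_int_eq_one (p := 3) (by norm_num)] at h16
  exact h16.false

theorem padicValuation_coeff_lt_one :
    Rat.padicValuation p (-432 * (p : ℚ) ^ 2) < 1 := by
  have h : Rat.padicValuation p (-432) ≤ 1 := by
    exact_mod_cast padicValuation_int_le_one (p := p) (-432)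
  rw [mul_comm, map_mul, map_pow]
  exact mul_lt_one_of_lt_of_le (pow_lt_one₀ zero_le padicValuation_self_lt_one two_ne_zero) h

/-- For `p ≠ 3` the factor `432 = 2⁴ · 3³` is a `p`-unit, so `a` has the valuation of `p²`, as the
component group argument needs. This fails at `3`, which is treated separately. -/
theorem nearInfinity_three_nsmul_cubeCurve (hodd : Odd p)
    (P : (curve (-432 * (p : ℚ) ^ 2)).Point) :
    NearInfinity (Rat.padicValuation p) (3 • P) := by
  have hp2 : ¬ p ∣ 2 := fun h => by
    have := (Nat.prime_dvd_prime_iff_eq hp.out Nat.prime_two).1 h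
    subst this; exact absurd hodd (by decide)
  by_cases h3 : p = 3
  · subst h3
    refine (nearInfinity_nsmul padicValuation_coeff_lt_one ?_ 3).1
    rcases P with _ | ⟨x, y, h⟩
    · exact nearInfinity_zero
    · have e := eq_of_nonsingular h
      refine integralAtInfinity_of_one_le_left padicValuation_coeff_lt_one e ?_
      exact one_le_padicValuation_three (by rw [e]; norm_num; ring)
  · have hp432 : ¬ (p : ℤ) ∣ -432 := by
      rw [Int.dvd_neg]
      intro h
      have h : p ∣ 2 ^ 4 * 3 ^ 3 := by exact_mod_cast h
      rcases (Nat.Prime.dvd_mul hp.out).1 h with h | h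
      · exact hp2 (hp.out.dvd_of_dvd_pow h)
      · exact h3 ((Nat.prime_dvd_prime_iff_eq hp.out Nat.prime_three).1
          (hp.out.dvd_of_dvd_pow h))
    refine nearInfinity_three_nsmul padicValuation_self_lt_one ?_ ?_
      (fun x => padicValuation_le_of_lt_one) P
    · exact_mod_cast padicValuation_int_eq_one (p := p) (n := 2) (by exact_mod_cast hp2)
    · have := padicValuation_int_eq_one hp432
      push_cast at this
      rw [map_mul, map_pow, this, one_mul]

theorem dvd_of_hasLowestTerms (hodd : Odd p) (P : (cubeCurve p).Point) {k : ℕ} {u v d : ℤ}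
    (h : HasLowestTerms ((3 * p * k) • P) u v d) : (p : ℤ) ∣ d := by
  obtain ⟨-, -, hns, e⟩ := h
  have hk : (3 * p * k) • P = p • (3 • (k • P)) := by
    rw [← mul_nsmul', ← mul_nsmul']; ring_nf
  rw [hk] at e
  have h1 := one_lt_of_nsmul_eq (a := -432 * (p : ℚ) ^ 2) padicValuation_coeff_lt_one
    (nearInfinity_three_nsmul_cubeCurve hodd (k • P)) padicValuation_self_lt_one e
  by_contra hd
  rw [map_div₀, map_pow, padicValuation_int_eq_one hd, one_pow, div_one] at h1
  exact absurd (padicValuation_int_le_one v) (not_le.2 h1)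

end Padic

/-! ### From points on `E` to sums of two cubes -/

section LowestTerms

variable {p : ℕ} {Q : (cubeCurve p).Point} {u v d : ℤ}

theorem equation_of_hasLowestTerms (h : HasLowestTerms Q u v d) :
    ((v : ℚ) / (d : ℚ) ^ 3) ^ 2 = ((u : ℚ) / (d : ℚ) ^ 2) ^ 3 + -432 * (p : ℚ) ^ 2 := by
  obtain ⟨-, -, hns, -⟩ := h
  exact eq_of_nonsingular (a := -432 * (p : ℚ) ^ 2) hns

theorem ne_zero_of_hasLowestTerms (hp : p.Prime) (h : HasLowestTerms Q u v d) : u ≠ 0 := by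
  rintro rfl
  have e := equation_of_hasLowestTerms h
  have : (0 : ℚ) < (p : ℚ) ^ 2 := pow_pos (by exact_mod_cast hp.pos) 2
  simp only [Int.cast_zero, zero_div] at e
  nlinarith [sq_nonneg ((v : ℚ) / (d : ℚ) ^ 3)]

theorem ratioPlus_cube_add_ratioMinus_cube (hp : p.Prime) (h : HasLowestTerms Q u v d) :
    ratioPlus p u v d ^ 3 + ratioMinus p u v d ^ 3 = p := by
  have hu : (u : ℚ) ≠ 0 := by exact_mod_cast ne_zero_of_hasLowestTerms hp h
  have hd : (d : ℚ) ≠ 0 := by exact_mod_cast h.1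
  have e := equation_of_hasLowestTerms h
  field_simp at e
  rw [ratioPlus, ratioMinus]
  field_simp
  linear_combination 216 * p * (d : ℚ) ^ 3 * e

/-- Were `A` integral at `p`, then `6ud · A = 36pd³ + v` would force `p ∣ v`, against `v` being
prime to `d`. -/
theorem dvd_den_ratioPlus (hp : p.Prime) (h : HasLowestTerms Q u v d) (hd : (p : ℤ) ∣ d) :
    p ∣ (ratioPlus p u v d).den := by
  have := Fact.mk hp
  have hv : ¬ (p : ℤ) ∣ v := fun hv =>
    (Nat.prime_iff_prime_int.1 hp).not_isUnit (h.2.1.isUnit_of_dvd' (hv.mul_left u) hd)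
  by_contra hden
  have hA := Rat.padicValuation_le_one_iff.2 hden
  have hu : (u : ℚ) ≠ 0 := by exact_mod_cast ne_zero_of_hasLowestTerms hp h
  have hd0 : (d : ℚ) ≠ 0 := by exact_mod_cast h.1
  have e : ((36 * p * d ^ 3 + v : ℤ) : ℚ) = ((6 * u * d : ℤ) : ℚ) * ratioPlus p u v d := by
    rw [ratioPlus]; push_cast; field_simp
  have hlt : Rat.padicValuation p ((36 * p * d ^ 3 + v : ℤ) : ℚ) < 1 := by
    rw [e, map_mul, Rat.padicValuation_cast]
    exact mul_lt_one_of_lt_of_le (Int.padicValuation_lt_one_iff.2 (hd.mul_left _)) hA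
  rw [Rat.padicValuation_cast, Int.padicValuation_lt_one_iff] at hlt
  refine hv ((dvd_add_right ?_).1 hlt)
  exact ((dvd_mul_left (p : ℤ) 36)).mul_right _

/-- The point is determined by the two ratios. -/
theorem eq_of_ratio_eq (hp : p.Prime) (h : HasLowestTerms Q u v d)
    {Q' : (cubeCurve p).Point} {u' v' d' : ℤ} (h' : HasLowestTerms Q' u' v' d')
    (hA : ratioPlus p u v d = ratioPlus p u' v' d')
    (hB : ratioMinus p u v d = ratioMinus p u' v' d') : Q = Q' := by
  have hp0 : (p : ℚ) ≠ 0 := by exact_mod_cast hp.ne_zero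
  have hu : (u : ℚ) ≠ 0 := by exact_mod_cast ne_zero_of_hasLowestTerms hp h
  have hd : (d : ℚ) ≠ 0 := by exact_mod_cast h.1
  have hu' : (u' : ℚ) ≠ 0 := by exact_mod_cast ne_zero_of_hasLowestTerms hp h'
  have hd' : (d' : ℚ) ≠ 0 := by exact_mod_cast h'.1
  have hX : (u : ℚ) / (d : ℚ) ^ 2 = (u' : ℚ) / (d' : ℚ) ^ 2 := by
    have s := congrArg₂ (· + ·) hA hB
    have t {u v d : ℚ} (hu : u ≠ 0) (hd : d ≠ 0) : u / d ^ 2 =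
        12 * p / ((36 * p * d ^ 3 + v) / (6 * u * d) + (36 * p * d ^ 3 - v) / (6 * u * d)) := by
      rw [← add_div, add_add_sub_cancel]
      field_simp; ring
    rw [t (v := v) hu hd, t (v := v') hu' hd']
    exact congrArg _ s
  have hY : (v : ℚ) / (d : ℚ) ^ 3 = (v' : ℚ) / (d' : ℚ) ^ 3 := by
    have s := congrArg₂ (· - ·) hA hB
    have t {u v d : ℚ} (hu : u ≠ 0) (hd : d ≠ 0) : v / d ^ 3 =
        3 * (u / d ^ 2) * ((36 * p * d ^ 3 + v) / (6 * u * d) -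
          (36 * p * d ^ 3 - v) / (6 * u * d)) := by
      field_simp; ring
    rw [t hu hd, t hu' hd', hX]
    exact congrArg _ s
  obtain ⟨-, -, hns, e⟩ := h
  obtain ⟨-, -, hns', e'⟩ := h'
  rw [e, e']
  simp only [hX, hY]

theorem exists_hasLowestTerms (hQ : Q ≠ 0) : ∃ u v d : ℤ, HasLowestTerms Q u v d := by
  rcases Q with _ | ⟨x, y, h⟩
  · exact absurd rfl hQ
  · have e : y ^ 2 = x ^ 3 + ((-432 * (p : ℤ) ^ 2 : ℤ) : ℚ) := by
      push_cast; exact eq_of_nonsingular (a := -432 * (p : ℚ) ^ 2) h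
    obtain ⟨u, v, d, hd, hc, rfl, rfl⟩ := exists_lowest_terms e
    exact ⟨u, v, d, hd, hc, h, rfl⟩

end LowestTerms

/-! ### Multiples of a point of infinite order -/

theorem nsmul_injective_of_not_isOfFinAddOrder {p : ℕ} {P : (cubeCurve p).Point}
    (hP : ¬ IsOfFinAddOrder P) : Function.Injective fun n : ℕ => n • P :=
  injective_nsmul_iff_not_isOfFinAddOrder.2 hP

theorem exists_hasLowestTerms_nsmul {p : ℕ} (hp : p.Prime) {P : (cubeCurve p).Point}
    (hP : ¬ IsOfFinAddOrder P) {k : ℕ} (hk : 1 ≤ k) :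
    ∃ u v d : ℤ, HasLowestTerms ((3 * p * k) • P) u v d := by
  refine exists_hasLowestTerms fun h0 => ?_
  have := nsmul_injective_of_not_isOfFinAddOrder hP (h0.trans (zero_nsmul P).symm)
  have h3p : 3 * p * k ≠ 0 :=
    mul_ne_zero (mul_ne_zero three_ne_zero hp.ne_zero) (Nat.one_le_iff_ne_zero.1 hk)
  exact h3p this

theorem isCoprimeSolution_of_hasLowestTerms {p : ℕ} (hp : p.Prime) (hodd : Odd p)
    {P : (cubeCurve p).Point} {k : ℕ} {u v d : ℤ}
    (h : HasLowestTerms ((3 * p * k) • P) u v d) :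
    (p : ℤ) ∣ d ∧ (ratioPlus p u v d).den = (ratioMinus p u v d).den ∧
      ∃ z : ℤ, ((ratioPlus p u v d).den : ℤ) = (p : ℤ) * z ∧
        IsCoprimeSolution p (ratioPlus p u v d).num (ratioMinus p u v d).num z := by
  have := Fact.mk hp
  have hd := dvd_of_hasLowestTerms hodd P h
  exact ⟨hd, isCoprimeSolution_of_cube_add_cube hp (ratioPlus_cube_add_ratioMinus_cube hp h)
    (dvd_den_ratioPlus hp h hd)⟩

theorem infinite_isCoprimeSolution {p : ℕ} (hp : p.Prime) (hodd : Odd p)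
    {P : (cubeCurve p).Point} (hP : ¬ IsOfFinAddOrder P) :
    {t : ℤ × ℤ × ℤ | IsCoprimeSolution p t.1 t.2.1 t.2.2}.Infinite := by
  -- The index is shifted to `k + 1` to avoid the zero multiple.
  choose u v d h using fun k : ℕ => exists_hasLowestTerms_nsmul hp hP (Nat.le_add_left 1 k)
  choose hd hden z hz hsol using fun k => isCoprimeSolution_of_hasLowestTerms hp hodd (h k)
  refine Set.infinite_of_injective_forall_mem
    (f := fun k => ((ratioPlus p (u k) (v k) (d k)).num, (ratioMinus p (u k) (v k) (d k)).num, z k))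
    (fun i j hij => ?_) hsol
  simp only [Prod.mk.injEq] at hij
  obtain ⟨hA, hB, hzz⟩ := hij
  have hD : (ratioPlus p (u i) (v i) (d i)).den = (ratioPlus p (u j) (v j) (d j)).den := by
    have := (hz i).trans (hzz ▸ (hz j).symm)
    exact_mod_cast this
  have hQ := eq_of_ratio_eq hp (h i) (h j) (Rat.ext hA hD)
    (Rat.ext hB (by rw [← hden i, ← hden j, hD]))
  have := nsmul_injective_of_not_isOfFinAddOrder hP hQ
  have h3p : 0 < 3 * p := Nat.mul_pos (by norm_num) hp.pos
  exact Nat.succ_injective (Nat.eq_of_mul_eq_mul_left h3p this)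

end Mordell

theorem theorem1p1 (p : ℕ) (hp : p.Prime) (hodd : Odd p)
    (hrank : 0 < Module.rank ℤ (cubeCurve p).Point) :
    {t : ℤ × ℤ × ℤ | IsCoprimeSolution p t.1 t.2.1 t.2.2}.Infinite ∧
    ∀ P : (cubeCurve p).Point, ¬ IsOfFinAddOrder P →
      ∀ k : ℕ, 1 ≤ k →
        (∃ u v d : ℤ, HasLowestTerms ((3 * p * k) • P) u v d) ∧
        ∀ u v d : ℤ, HasLowestTerms ((3 * p * k) • P) u v d →
          (p : ℤ) ∣ d ∧
          (ratioPlus p u v d).den = (ratioMinus p u v d).den ∧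
          ∃ z : ℤ, ((ratioPlus p u v d).den : ℤ) = (p : ℤ) * z ∧
            IsCoprimeSolution p (ratioPlus p u v d).num (ratioMinus p u v d).num z := by
  refine ⟨?_, fun P hP k hk => ⟨Mordell.exists_hasLowestTerms_nsmul hp hP hk,
    fun u v d h => Mordell.isCoprimeSolution_of_hasLowestTerms hp hodd h⟩⟩
  obtain ⟨P, hP⟩ : ∃ P : (cubeCurve p).Point, ¬ IsOfFinAddOrder P := by
    by_contra! hall
    refine hrank.ne' (rank_eq_zero_iff.2 fun P => ?_)
    obtain ⟨n, hn, e⟩ := isOfFinAddOrder_iff_zsmul_eq_zero.1 (hall P)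
    exact ⟨n, hn, e⟩
  exact Mordell.infinite_isCoprimeSolution hp hodd hP
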